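/- Let $F$ be a field of characteristic zero and let $\Gamma\neq\{0\}$ be a nonzero additive subgroup of $F$. Let $F[\Gamma]$ be the group algebra with basis $\{e^\alpha\mid\alpha\in\Gamma\}$, let $\partial$ be the linear operator with $\partial(e^\alpha)=\alpha e^\alpha$, and let $W(\Gamma)=F[\Gamma]\partial$ be the Lie algebra with bracket $[f\partial,g\partial]=(f\,\partial(g)-g\,\partial(f))\partial$. Let $L=W(\Gamma)\otimes F[t,t^{-1}]$ be the generalized loop Virasoro algebra, i.e. the Lie algebra with basis $L_{\alpha,i}=e^\alpha\partial\otimes t^i$ ($\alpha\in\Gamma$, $i\in\mathbb Z$) and bracket $$[L_{\alpha,i},L_{\beta,j}]=(\beta-\alpha)L_{\alpha+\beta,i+j}.$$ All tensor products are over $F$, and $L$ acts on $L\otimes L$ by the diagonal adjoint action $x\cdot(a\otimes b)=[x,a]\otimes b+a\otimes[x,b]$. Let $\tau(x\otimes y)=y\otimes x$ on $L\otimes L$ and $\varepsilon(x_1\otimes x_2\otimes x_3)=x_2\otimes x_3\otimes x_1$ on $L\otimes L\otimes L$. Let $\Delta:L\to L\otimes L$ be a linear map making $L$ with its given bracket a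 Lie bialgebra, that is, 1. $\operatorname{Im}\Delta\subseteq\operatorname{Im}(1\otimes 1-\tau)$; 2. $(1\otimes1\otimes1+\varepsilon+\varepsilon^2)(1\otimes\Delta)\Delta=0$; 3. $\Delta([x,y])=x\cdot\Delta(y)-y\cdot\Delta(x)$ for all $x,y\in L$. Then this Lie bialgebra is coboundary triangular: there is $r\in\operatorname{Im}(1\otimes1-\tau)\subseteq L\otimes L$ such that $\Delta(x)=x\cdot r$ for all $x\in L$ and $r$ satisfies the classical Yang–Baxter equation $$c(r)=[r^{12},r^{13}]+[r^{12},r^{23}]+[r^{13},r^{23}]=0\quad\text{in } U(L)\otimes U(L)\otimes U(L),$$ where $U(L)$ is the universal enveloping algebra of $L$ and, for $r=\sum_i a_i\otimes b_i$, $r^{12}=\sum_i a_i\otimes b_i\otimes1$, $r^{13}=\sum_i a_i\otimes1\otimes b_i$, $r^{23}=\sum_i1\otimes a_i\otimes b_i$. -/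

import Mathlib

open scoped TensorProduct

noncomputable section

namespace LieBialg

section General

attribute [local instance 100] LieRing.ofAssociativeRing LieAlgebra.ofAssociativeAlgebra

variable (F L : Type*) [Field F] [LieRing L] [LieAlgebra F L]

/-- The twist `x ⊗ y ↦ y ⊗ x` of `L ⊗ L`. -/
def twist : L ⊗[F] L →ₗ[F] L ⊗[F] L :=
  (TensorProduct.comm F L L).toLinearMap

/-- The cyclic permutation `x₁ ⊗ x₂ ⊗ x₃ ↦ x₂ ⊗ x₃ ⊗ x₁` of `L ⊗ L ⊗ L`. -/
def cyc : L ⊗[F] (L ⊗[F] L) →ₗ[F] L ⊗[F] (L ⊗[F] L) :=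
  (TensorProduct.assoc F L L L).toLinearMap ∘ₗ (TensorProduct.comm F L (L ⊗[F] L)).toLinearMap

theorem twist_tmul (x y : L) : twist F L (x ⊗ₜ y) = y ⊗ₜ x := rfl

theorem cyc_tmul (x y z : L) : cyc F L (x ⊗ₜ (y ⊗ₜ z)) = y ⊗ₜ (z ⊗ₜ x) := rfl

/-- The skew-symmetric tensors `Im (1 ⊗ 1 - τ)`. -/
def skewTensors : Submodule F (L ⊗[F] L) :=
  LinearMap.range (LinearMap.id - twist F L)

variable {L}

/-- `(L, Δ)` is a Lie coalgebra: `Im Δ ⊆ Im (1 ⊗ 1 - τ)` and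
`(1 + ε + ε²) (1 ⊗ Δ) Δ = 0`. -/
structure IsLieCoalgebra (Δ : L →ₗ[F] L ⊗[F] L) : Prop where
  range_le : LinearMap.range Δ ≤ skewTensors F L
  coJacobi : (LinearMap.id + cyc F L + cyc F L ∘ₗ cyc F L) ∘ₗ (Δ.lTensor L) ∘ₗ Δ = 0

/-- The Lie algebra `L` with the cobracket `Δ` is a Lie bialgebra; `L` acts on `L ⊗ L` by the
diagonal adjoint action. -/
structure IsLieBialgebra (Δ : L →ₗ[F] L ⊗[F] L) : Prop extends IsLieCoalgebra F Δ where
  compat : ∀ x y : L, Δ ⁅x, y⁆ = ⁅x, Δ y⁆ - ⁅y, Δ x⁆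

/-- `(L, [·,·], Δ, r)` is a coboundary Lie bialgebra. -/
structure IsCoboundaryLieBialgebra (Δ : L →ₗ[F] L ⊗[F] L) (r : L ⊗[F] L) : Prop
    extends IsLieBialgebra F Δ where
  skew : r ∈ skewTensors F L
  coboundary : ∀ x : L, Δ x = ⁅x, r⁆

variable (L) in
/-- The canonical linear map from `L` to its universal enveloping algebra `U(L)`. -/
def toU : L →ₗ[F] UniversalEnvelopingAlgebra F L :=
  (UniversalEnvelopingAlgebra.ι F : L →ₗ⁅F⁆ UniversalEnvelopingAlgebra F L).toLinearMap

variable (L) in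
/-- The algebra `U(L) ⊗ U(L) ⊗ U(L)`. -/
abbrev U3 : Type _ :=
  UniversalEnvelopingAlgebra F L ⊗[F]
    (UniversalEnvelopingAlgebra F L ⊗[F] UniversalEnvelopingAlgebra F L)

variable (L) in
/-- `r = ∑ aᵢ ⊗ bᵢ ↦ r¹² = ∑ aᵢ ⊗ bᵢ ⊗ 1`. -/
def r12 : L ⊗[F] L →ₗ[F] U3 F L :=
  TensorProduct.map (toU F L) ((TensorProduct.mk F _ _).flip 1 ∘ₗ toU F L)

variable (L) in
/-- `r = ∑ aᵢ ⊗ bᵢ ↦ r¹³ = ∑ aᵢ ⊗ 1 ⊗ bᵢ`. -/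
def r13 : L ⊗[F] L →ₗ[F] U3 F L :=
  TensorProduct.map (toU F L) (TensorProduct.mk F _ _ 1 ∘ₗ toU F L)

variable (L) in
/-- `r = ∑ aᵢ ⊗ bᵢ ↦ r²³ = ∑ 1 ⊗ aᵢ ⊗ bᵢ`. -/
def r23 : L ⊗[F] L →ₗ[F] U3 F L :=
  TensorProduct.mk F _ _ 1 ∘ₗ TensorProduct.map (toU F L) (toU F L)

theorem r12_tmul (a b : L) : r12 F L (a ⊗ₜ b) = toU F L a ⊗ₜ (toU F L b ⊗ₜ 1) := rfl

theorem r13_tmul (a b : L) : r13 F L (a ⊗ₜ b) = toU F L a ⊗ₜ (1 ⊗ₜ toU F L b) := rfl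

theorem r23_tmul (a b : L) : r23 F L (a ⊗ₜ b) = 1 ⊗ₜ (toU F L a ⊗ₜ toU F L b) := rfl

/-- `c(r) = [r¹², r¹³] + [r¹², r²³] + [r¹³, r²³]`, with commutators in the associative algebra
`U(L) ⊗ U(L) ⊗ U(L)`. -/
def cybe (r : L ⊗[F] L) : U3 F L :=
  (r12 F L r * r13 F L r - r13 F L r * r12 F L r) +
    (r12 F L r * r23 F L r - r23 F L r * r12 F L r) +
    (r13 F L r * r23 F L r - r23 F L r * r13 F L r)

/-- `(L, [·,·], Δ, r)` is a coboundary triangular Lie bialgebra: it is a coboundary Lie bialgebra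
and `r` satisfies the classical Yang-Baxter equation. -/
structure IsCoboundaryTriangular (Δ : L →ₗ[F] L ⊗[F] L) (r : L ⊗[F] L) : Prop
    extends IsCoboundaryLieBialgebra F Δ r where
  cybe_eq_zero : cybe F r = 0

end General

section Witt

variable {F : Type*} [Field F] (Γ : AddSubgroup F)

/-- The linear operator `∂ (e^α) = α e^α` on the group algebra `F[Γ]`. -/
def partialD : AddMonoidAlgebra F Γ →ₗ[F] AddMonoidAlgebra F Γ :=
  (AddMonoidAlgebra.basis Γ F).constr F fun α => AddMonoidAlgebra.single α (α : F)

theorem partialD_single (α : Γ) (c : F) :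
    partialD Γ (AddMonoidAlgebra.single α c) = AddMonoidAlgebra.single α (c * α) := by
  have h : (AddMonoidAlgebra.single α c : AddMonoidAlgebra F Γ)
      = c • AddMonoidAlgebra.basis Γ F α := by simp
  rw [h, map_smul, partialD, Module.Basis.constr_basis]
  simp

theorem partialD_mul (f g : AddMonoidAlgebra F Γ) :
    partialD Γ (f * g) = partialD Γ f * g + f * partialD Γ g := by
  induction f using AddMonoidAlgebra.induction_linear with
  | zero => simp
  | add f₁ f₂ h₁ h₂ => simp only [add_mul, map_add, h₁, h₂]; abel
  | single α a =>
    induction g using AddMonoidAlgebra.induction_linear with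
    | zero => simp
    | add g₁ g₂ h₁ h₂ => simp only [mul_add, map_add, h₁, h₂]; abel
    | single β b =>
      simp only [AddMonoidAlgebra.single_mul_single, partialD_single,
        ← AddMonoidAlgebra.single_add]
      congr 1
      push_cast
      ring

/-- The generalized (centerless) Virasoro algebra `W(Γ) = F[Γ]∂`: the element `f ∂` is
represented by its coefficient `f ∈ F[Γ]`. -/
def W : Type _ := AddMonoidAlgebra F Γ

instance : AddCommGroup (W Γ) := inferInstanceAs (AddCommGroup (AddMonoidAlgebra F Γ))

instance : Module F (W Γ) := inferInstanceAs (Module F (AddMonoidAlgebra F Γ))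

/-- The linear identification `f ↦ f ∂` of `F[Γ]` with `W(Γ)`. -/
def toW : AddMonoidAlgebra F Γ ≃ₗ[F] W Γ := LinearEquiv.refl F _

/-- The commutator of vector fields, `[f ∂, g ∂] = (f ∂(g) - g ∂(f)) ∂`. -/
instance : Bracket (W Γ) (W Γ) where
  bracket x y := toW Γ ((toW Γ).symm x * partialD Γ ((toW Γ).symm y)
    - (toW Γ).symm y * partialD Γ ((toW Γ).symm x))

theorem W_lie_def (x y : W Γ) :
    ⁅x, y⁆ = toW Γ ((toW Γ).symm x * partialD Γ ((toW Γ).symm y)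
      - (toW Γ).symm y * partialD Γ ((toW Γ).symm x)) := rfl

instance : LieRing (W Γ) where
  add_lie x y z := by
    simp only [W_lie_def, ← map_add]
    congr 1
    simp only [map_add]
    ring
  lie_add x y z := by
    simp only [W_lie_def, ← map_add]
    congr 1
    simp only [map_add]
    ring
  lie_self x := by simp [W_lie_def]
  leibniz_lie x y z := by
    simp only [W_lie_def, ← map_add]
    congr 1
    simp only [LinearEquiv.symm_apply_apply, map_sub, partialD_mul]
    ring

instance : LieAlgebra F (W Γ) where
  lie_smul c x y := by
    simp only [W_lie_def, ← map_smul]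
    congr 1
    simp only [map_smul, smul_sub, mul_smul_comm, smul_mul_assoc]

/-- The basis vector `L_α = e^α ∂` of `W(Γ)`. -/
def wittL (α : Γ) : W Γ := toW Γ (AddMonoidAlgebra.single α 1)

theorem wittL_lie (α β : Γ) :
    ⁅wittL Γ α, wittL Γ β⁆ = ((β : F) - (α : F)) • wittL Γ (α + β) := by
  rw [W_lie_def]
  simp only [wittL, LinearEquiv.symm_apply_apply, partialD_single,
    AddMonoidAlgebra.single_mul_single, ← map_smul]
  congr 1
  rw [add_comm β α, ← AddMonoidAlgebra.single_sub]
  simp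

/-- The generalized loop Virasoro algebra, the Lie algebra `F[t, t⁻¹] ⊗ W(Γ)` over `F` with
bracket `[p ⊗ x, q ⊗ y] = pq ⊗ [x, y]`. -/
abbrev LoopVirasoro : Type _ := LieAlgebra.loopAlgebra F ℤ (W Γ)

/-- The basis vector `L_{α,i} = L_α t^i`. -/
def loopL (α : Γ) (i : ℤ) : LoopVirasoro Γ := AddMonoidAlgebra.single i (1 : F) ⊗ₜ[F] wittL Γ α

theorem loopL_lie (α β : Γ) (i j : ℤ) :
    ⁅loopL Γ α i, loopL Γ β j⁆ = ((β : F) - (α : F)) • loopL Γ (α + β) (i + j) := by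
  simp only [loopL, LieAlgebra.ExtendScalars.bracket_tmul, wittL_lie,
    AddMonoidAlgebra.single_mul_single, mul_one, TensorProduct.tmul_smul]

end Witt

end LieBialg

end

/-!
Every cobracket on the generalized loop Virasoro algebra `L = W(Γ) ⊗ F[t, t⁻¹]` comes from a
triangular `r`, because `L` has vanishing first cohomology with values in `L ⊗ L` and no nonzero
invariants in `L ⊗ N` for any Lie module `N`.

*Invariants* (`eq_zero_of_lie_eq_zero`). Write `u ∈ L ⊗ N` as `∑ L_{x,i} ⊗ n_{x,i}`. For all but
finitely many `α ∈ Γ`, the coefficient of `L_α · u` at `L_{x+α,i}` is `(x - α) n_{x,i}`, so an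
invariant `u` vanishes. The same idea of moving a finite support off itself shows that
there is no nonzero `W(Γ)`-homomorphism from `W(Γ)` to `W(Γ) ⊗ W(Γ) ⊗ V`, where `W(Γ)` acts
trivially on `V` (`equivariant_eq_zero`).

*Cohomology* (`exists_eq_coboundaryMap`). Put `L ⊗ L = W(Γ) ⊗ W(Γ) ⊗ F[t^±, s^±]`. The elements
`L_{α,1} - s L_{α,0}` and `L_{α,1} - t L_{α,0}`, formed with coefficients in `F[t^±, s^±]`, act on
the left, respectively the right, factor only, through `±(t - s) L_α`. A derivation
`D : L → L ⊗ L` extends to them, and its values on the elements `(u - t)(u - s) L_γ`, where `uⁱ L_γ`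
stands for `L_{γ,i}`, form a `W(Γ)`-homomorphism because these elements act by zero; hence
these values vanish. Therefore `D` respects the relation
`[L_{α,1} - s L_{α,0}, L_{β,1} - t L_{β,0}] ≡ 0`, which says that the left action of `L_α` on
`D (L_{β,1} - t L_{β,0})` is minus the right action of `L_β` on `D (L_{α,1} - s L_{α,0})`. Comparing
coefficients, both families are explicit multiples of one finitely supported function
(`exists_potential`). It is divisible by `t - s`, and the quotient `r` satisfies
`D(L_{α,0}) = L_{α,0} · r`. The difference of `D` and `x ↦ x · r` vanishes on `W(Γ)`, so
on each `W(Γ) tⁱ` it is a `W(Γ)`-homomorphism and vanishes too.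

*Conclusion.* With `Δ(x) = x · r`, the tensor `r + τ r` is invariant, so `r` is skew-symmetric, and
by Drinfeld's identity (`coJacobi_coboundaryMap`) the co-Jacobi identity says that
`c(r) ∈ L ⊗ L ⊗ L` is invariant, so `c(r) = 0`.
-/

namespace LieBialg

/-! ### The Yang–Baxter map and the co-Jacobi identity -/

section YangBaxter

variable (F L : Type*) [Field F] [LieRing L] [LieAlgebra F L]

/-- The bilinear map polarizing `[r¹², r¹³] + [r¹², r²³] + [r¹³, r²³]`, with values in
`L ⊗ L ⊗ L` instead of the tensor cube of the enveloping algebra. -/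
noncomputable def yangBaxter : (L ⊗[F] L) ⊗[F] (L ⊗[F] L) →ₗ[F] L ⊗[F] (L ⊗[F] L) :=
  let br : L ⊗[F] L →ₗ[F] L := (LieModule.toModuleHom F L L : L ⊗[F] L →ₗ[F] L)
  br.rTensor (L ⊗[F] L) ∘ₗ (TensorProduct.tensorTensorTensorComm F L L L L).toLinearMap +
    (br.rTensor L ∘ₗ (TensorProduct.assoc F L L L).symm.toLinearMap).lTensor L ∘ₗ
      (TensorProduct.assoc F L L (L ⊗[F] L)).toLinearMap +
    (TensorProduct.assoc F L L L).toLinearMap ∘ₗ br.lTensor (L ⊗[F] L) ∘ₗ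
      (TensorProduct.tensorTensorTensorComm F L L L L).toLinearMap

variable {L}

theorem yangBaxter_tmul (a b c d : L) :
    yangBaxter F L ((a ⊗ₜ b) ⊗ₜ (c ⊗ₜ d)) =
      ⁅a, c⁆ ⊗ₜ (b ⊗ₜ d) + a ⊗ₜ (⁅b, c⁆ ⊗ₜ d) + a ⊗ₜ (c ⊗ₜ ⁅b, d⁆) := by
  simp [yangBaxter]

theorem toU_lie (a b : L) :
    toU F L ⁅a, b⁆ = toU F L a * toU F L b - toU F L b * toU F L a := by
  let _ : LieRing (UniversalEnvelopingAlgebra F L) := LieRing.ofAssociativeRing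
  exact LieHom.map_lie (UniversalEnvelopingAlgebra.ι F) a b

theorem cybe_polarized (r s : L ⊗[F] L) :
    (r12 F L r * r13 F L s - r13 F L s * r12 F L r) +
      (r12 F L r * r23 F L s - r23 F L s * r12 F L r) +
      (r13 F L r * r23 F L s - r23 F L s * r13 F L r) =
    TensorProduct.map (toU F L) (TensorProduct.map (toU F L) (toU F L))
      (yangBaxter F L (r ⊗ₜ s)) := by
  induction r with
  | zero => simp
  | add r₁ r₂ h₁ h₂ =>
    simp only [TensorProduct.add_tmul, map_add, ← h₁, ← h₂, add_mul, mul_add]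
    abel
  | tmul a b =>
    induction s with
    | zero => simp
    | add s₁ s₂ h₁ h₂ =>
      simp only [TensorProduct.tmul_add, map_add, ← h₁, ← h₂, add_mul, mul_add]
      abel
    | tmul c d =>
      simp only [r12_tmul, r13_tmul, r23_tmul, yangBaxter_tmul, map_add, TensorProduct.map_tmul,
        toU_lie, Algebra.TensorProduct.tmul_mul_tmul, mul_one, one_mul, TensorProduct.sub_tmul,
        TensorProduct.tmul_sub]

theorem cybe_eq_map_yangBaxter (r : L ⊗[F] L) :
    cybe F r = TensorProduct.map (toU F L) (TensorProduct.map (toU F L) (toU F L))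
      (yangBaxter F L (r ⊗ₜ r)) :=
  cybe_polarized F r r

/-- The coboundary `x ↦ x · r`. -/
noncomputable def coboundaryMap (r : L ⊗[F] L) : L →ₗ[F] L ⊗[F] L :=
  (LieModule.toEnd F L (L ⊗[F] L) : L →ₗ[F] Module.End F (L ⊗[F] L)).flip r

@[simp] theorem coboundaryMap_apply (r : L ⊗[F] L) (x : L) :
    coboundaryMap F r x = ⁅x, r⁆ := rfl

/-- The polarization in `r` of `(1 + ε + ε²)(1 ⊗ Δ) Δ(x) - x · c(r)` for `Δ(x) = x · r`. -/
noncomputable def coJacobiDefect (x : L) (r s : L ⊗[F] L) : L ⊗[F] (L ⊗[F] L) :=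
  (LinearMap.id + cyc F L + cyc F L ∘ₗ cyc F L : L ⊗[F] (L ⊗[F] L) →ₗ[F] L ⊗[F] (L ⊗[F] L))
      ((coboundaryMap F s).lTensor L ⁅x, r⁆) -
    ⁅x, yangBaxter F L (r ⊗ₜ s)⁆

theorem coboundaryMap_add (r s : L ⊗[F] L) :
    coboundaryMap F (r + s) = coboundaryMap F r + coboundaryMap F s := by
  ext x; simp

theorem coJacobiDefect_add_left (x : L) (r r' s : L ⊗[F] L) :
    coJacobiDefect F x (r + r') s = coJacobiDefect F x r s + coJacobiDefect F x r' s := by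
  simp only [coJacobiDefect, lie_add, map_add, TensorProduct.add_tmul]
  abel

theorem coJacobiDefect_add_right (x : L) (r s s' : L ⊗[F] L) :
    coJacobiDefect F x r (s + s') = coJacobiDefect F x r s + coJacobiDefect F x r s' := by
  simp only [coJacobiDefect, coboundaryMap_add, LinearMap.lTensor_add, LinearMap.add_apply,
    lie_add, map_add, TensorProduct.tmul_add]
  abel

theorem coJacobiDefect_zero_left (x : L) (s : L ⊗[F] L) : coJacobiDefect F x 0 s = 0 := by
  simpa using coJacobiDefect_add_left F x 0 0 s

theorem coJacobiDefect_zero_right (x : L) (r : L ⊗[F] L) : coJacobiDefect F x r 0 = 0 := by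
  simpa using coJacobiDefect_add_right F x r 0 0

theorem coJacobiDefect_tmul (x a b c d : L) :
    coJacobiDefect F x (a ⊗ₜ b) (c ⊗ₜ d) =
      a ⊗ₜ (⁅⁅x, b⁆, c⁆ ⊗ₜ d) + a ⊗ₜ (c ⊗ₜ ⁅⁅x, b⁆, d⁆)
      + (⁅b, c⁆ ⊗ₜ (d ⊗ₜ ⁅x, a⁆) + c ⊗ₜ (⁅b, d⁆ ⊗ₜ ⁅x, a⁆) + ⁅⁅x, b⁆, c⁆ ⊗ₜ (d ⊗ₜ a) +
        c ⊗ₜ (⁅⁅x, b⁆, d⁆ ⊗ₜ a))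
      + (d ⊗ₜ (⁅x, a⁆ ⊗ₜ ⁅b, c⁆) + ⁅b, d⁆ ⊗ₜ (⁅x, a⁆ ⊗ₜ c) + d ⊗ₜ (a ⊗ₜ ⁅⁅x, b⁆, c⁆) +
        ⁅⁅x, b⁆, d⁆ ⊗ₜ (a ⊗ₜ c))
      - (⁅x, ⁅a, c⁆⁆ ⊗ₜ (b ⊗ₜ d) + ⁅a, c⁆ ⊗ₜ (⁅x, b⁆ ⊗ₜ d) + ⁅a, c⁆ ⊗ₜ (b ⊗ₜ ⁅x, d⁆)
        + a ⊗ₜ (⁅x, ⁅b, c⁆⁆ ⊗ₜ d) + a ⊗ₜ (⁅b, c⁆ ⊗ₜ ⁅x, d⁆)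
        + a ⊗ₜ (⁅x, c⁆ ⊗ₜ ⁅b, d⁆) + a ⊗ₜ (c ⊗ₜ ⁅x, ⁅b, d⁆⁆)) := by
  simp only [coJacobiDefect, TensorProduct.LieModule.lie_tmul_right, map_add, yangBaxter_tmul,
    LinearMap.lTensor_tmul, coboundaryMap_apply, LinearMap.add_apply, LinearMap.id_apply,
    LinearMap.comp_apply, cyc_tmul, lie_add, TensorProduct.tmul_add]
  abel

/-- The defect vanishes on skew-symmetric tensors only after symmetrization in its two tensor
arguments: the terms with double brackets cancel by the Jacobi identity between the two orders. -/
theorem coJacobiDefect_symm_of_skew_tmul (x a b c d : L) :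
    coJacobiDefect F x (a ⊗ₜ b - b ⊗ₜ a) (c ⊗ₜ d - d ⊗ₜ c) +
      coJacobiDefect F x (c ⊗ₜ d - d ⊗ₜ c) (a ⊗ₜ b - b ⊗ₜ a) = 0 := by
  -- The differences become sums so that biadditivity of the defect suffices to expand it.
  have hn (u v : L) : u ⊗ₜ[F] v - v ⊗ₜ u = u ⊗ₜ v + (-v) ⊗ₜ u := by
    rw [TensorProduct.neg_tmul, sub_eq_add_neg]
  have hj (u v : L) : ⁅x, ⁅u, v⁆⁆ = ⁅⁅x, u⁆, v⁆ - ⁅⁅x, v⁆, u⁆ := by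
    rw [leibniz_lie, ← lie_skew u ⁅x, v⁆, sub_eq_add_neg]
  simp only [hn, coJacobiDefect_add_left, coJacobiDefect_add_right, coJacobiDefect_tmul, hj]
  simp only [TensorProduct.neg_tmul, TensorProduct.tmul_neg, TensorProduct.sub_tmul,
    TensorProduct.tmul_sub, neg_lie, lie_neg, neg_neg]
  rw [← lie_skew c a, ← lie_skew c b, ← lie_skew d a, ← lie_skew d b]
  simp only [TensorProduct.neg_tmul, TensorProduct.tmul_neg]
  abel

theorem coJacobiDefect_symm_of_skew (x : L) (u v : L ⊗[F] L) :
    coJacobiDefect F x (u - twist F L u) (v - twist F L v) +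
      coJacobiDefect F x (v - twist F L v) (u - twist F L u) = 0 := by
  induction u with
  | zero => simp [coJacobiDefect_zero_left, coJacobiDefect_zero_right]
  | add u₁ u₂ h₁ h₂ =>
    rw [map_add, add_sub_add_comm, coJacobiDefect_add_left, coJacobiDefect_add_right,
      add_add_add_comm, h₁, h₂, add_zero]
  | tmul a b =>
    induction v with
    | zero => simp [coJacobiDefect_zero_left, coJacobiDefect_zero_right]
    | add v₁ v₂ h₁ h₂ =>
      rw [map_add, add_sub_add_comm, coJacobiDefect_add_left, coJacobiDefect_add_right,
        add_add_add_comm, h₁, h₂, add_zero]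
    | tmul c d => exact coJacobiDefect_symm_of_skew_tmul F x a b c d

/-- Drinfeld's identity: for a skew-symmetric `r` and `Δ(x) = x · r`, the co-Jacobi expression
`(1 + ε + ε²)(1 ⊗ Δ) Δ(x)` equals `x · c(r)`. -/
theorem coJacobi_coboundaryMap [CharZero F] {r : L ⊗[F] L} (hr : r ∈ skewTensors F L) (x : L) :
    (LinearMap.id + cyc F L + cyc F L ∘ₗ cyc F L : L ⊗[F] (L ⊗[F] L) →ₗ[F] L ⊗[F] (L ⊗[F] L))
      ((coboundaryMap F r).lTensor L ⁅x, r⁆) =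
      ⁅x, yangBaxter F L (r ⊗ₜ r)⁆ := by
  obtain ⟨u, rfl⟩ := hr
  have h := coJacobiDefect_symm_of_skew F x u u
  rw [← two_smul F, smul_eq_zero_iff_right two_ne_zero] at h
  exact sub_eq_zero.mp h

theorem mem_skewTensors_of_twist_eq_neg [CharZero F] {r : L ⊗[F] L} (h : twist F L r = -r) :
    r ∈ skewTensors F L := by
  refine ⟨(2⁻¹ : F) • r, ?_⟩
  rw [map_smul, LinearMap.sub_apply, h, LinearMap.id_apply, sub_neg_eq_add, ← two_smul F, smul_smul,
    inv_mul_cancel₀ two_ne_zero, one_smul]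

theorem twist_lie (x : L) (r : L ⊗[F] L) : twist F L ⁅x, r⁆ = ⁅x, twist F L r⁆ := by
  induction r with
  | zero => simp
  | add r₁ r₂ h₁ h₂ => simp only [lie_add, map_add, h₁, h₂]
  | tmul a b =>
    simp only [TensorProduct.LieModule.lie_tmul_right, map_add, twist_tmul]
    abel

theorem twist_eq_neg_of_mem_skewTensors {r : L ⊗[F] L} (hr : r ∈ skewTensors F L) :
    twist F L r = -r := by
  obtain ⟨u, rfl⟩ := hr
  have h : twist F L (twist F L u) = u := by simp [twist]
  simp [h]

end YangBaxter

/-! ### Coefficient functions on `Γ × Γ` -/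

section FinitelySupported

variable {F : Type*} [Field F] {Γ : AddSubgroup F}

theorem infinite_of_ne_bot [CharZero F] (hΓ : Γ ≠ ⊥) : Infinite Γ := by
  obtain ⟨a, ha, ha0⟩ := Γ.bot_or_exists_ne_zero.resolve_left hΓ
  refine Infinite.of_injective (fun n : ℕ => (n • ⟨a, ha⟩ : Γ)) fun m n h => ?_
  simpa [ha0] using congrArg (Subtype.val : Γ → F) h

open Filter in
theorem eventually_finsupp_comp_eq_zero {ι V : Type*} [Zero V] (f : ι →₀ V) {g : Γ → ι}
    (hg : Function.Injective g) : ∀ᶠ α in cofinite, f (g α) = 0 := by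
  have h : ∀ᶠ p in cofinite, f p = 0 := f.hasFiniteSupport
  exact hg.tendsto_cofinite.eventually h

variable {V : Type*} [AddCommGroup V] [Module F V]

/-- The action of `L_α` on the left factor of `W(Γ) ⊗ W(Γ) ⊗ V`, where a tensor
`∑ L_x ⊗ L_y ⊗ f (x, y)` is represented by its coefficient function `f`. -/
def actLeft (α : Γ) (f : Γ × Γ → V) (p : Γ × Γ) : V :=
  ((p.1 : F) - 2 * α) • f (p.1 - α, p.2)

/-- The action of `L_α` on the right factor of `W(Γ) ⊗ W(Γ) ⊗ V`, in terms of coefficient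
functions. -/
def actRight (α : Γ) (f : Γ × Γ → V) (p : Γ × Γ) : V :=
  ((p.2 : F) - 2 * α) • f (p.1, p.2 - α)

open Filter in
/-- There is no nonzero `W(Γ)`-module homomorphism `φ : W(Γ) → W(Γ) ⊗ W(Γ) ⊗ V`. Indeed
`φ(L_α)` is a multiple of `L_α · u` for `u = φ(L_0)`, so that `[L_α, L_α] = 0` forces
`L_α · (L_α · u) = 0`; comparing coefficients for `α` outside a finite set gives `u = 0`. -/
theorem equivariant_eq_zero [CharZero F] (hΓ : Γ ≠ ⊥) (φ : Γ → (Γ × Γ →₀ V))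
    (h : ∀ (α γ : Γ) p, ((γ : F) - α) • φ (α + γ) p = actLeft α (φ γ) p + actRight α (φ γ) p)
    (γ : Γ) :
    φ γ = 0 := by
  have : Infinite Γ := infinite_of_ne_bot hΓ
  -- the coefficient of `L_α · (L_α · φ 0) = 0` at `(x, y)`
  have key (α x y : Γ) :
      0 = ((x : F) - 2 * α) • (((x : F) - 3 * α) • φ 0 (x - α - α, y)
          + ((y : F) - 2 * α) • φ 0 (x - α, y - α))
        + ((y : F) - 2 * α) • (((x : F) - 2 * α) • φ 0 (x - α, y - α)
          + ((y : F) - 3 * α) • φ 0 (x, y - α - α)) := by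
    have h₀ := h α α (x, y)
    have h₁ := h α 0 (x - α, y)
    have h₂ := h α 0 (x, y - α)
    simp only [actLeft, actRight, sub_self, zero_smul, add_zero, AddSubgroup.coe_sub,
      AddSubgroup.coe_zero] at h₀ h₁ h₂
    have h₃ : (0 : V) = (-(α : F)) • (((x : F) - 2 * α) • φ α (x - α, y)
        + ((y : F) - 2 * α) • φ α (x, y - α)) := by rw [← h₀, smul_zero]
    rw [zero_sub] at h₁ h₂
    rw [h₃, smul_add, smul_comm, h₁, smul_comm (-(α : F)), h₂]
    module
  have inj₁ (x y : Γ) : Function.Injective fun α : Γ => (x + α, y - α) := fun a b hab => by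
    simpa using congrArg Prod.fst hab
  have inj₂ (x y : Γ) : Function.Injective fun α : Γ => (x + α + α, y - α - α) := fun a b hab => by
    have h' := congrArg (fun p : Γ × Γ => (p.1 : F)) hab
    simp only [AddSubgroup.coe_add, add_assoc, add_right_inj, ← two_mul] at h'
    exact Subtype.ext (mul_left_cancel₀ two_ne_zero h')
  have inj₃ (x y : Γ) : Function.Injective fun α : Γ => (x - α, y + α) := fun a b hab => by
    simpa using congrArg Prod.fst hab
  have inj₄ (x y : Γ) : Function.Injective fun α : Γ => (x - α - α, y + α + α) := fun a b hab => by
    have h' := congrArg (fun p : Γ × Γ => (p.2 : F)) hab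
    simp only [AddSubgroup.coe_add, add_assoc, add_right_inj, ← two_mul] at h'
    exact Subtype.ext (mul_left_cancel₀ two_ne_zero h')
  have left (x y : Γ) (hx : x ≠ 0) : φ 0 (x, y) = 0 := by
    obtain ⟨α, h₁, h₂, h₃⟩ := ((eventually_finsupp_comp_eq_zero (φ 0) (inj₁ x y)).and
      ((eventually_finsupp_comp_eq_zero (φ 0) (inj₂ x y)).and (eventually_cofinite_ne x))).exists
    have hk := key α (x + α + α) y
    simp only [add_sub_cancel_right, h₁, h₂, smul_zero, add_zero, AddSubgroup.coe_add] at hk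
    have e₁ : (x : F) + α + α - 2 * α = x := by ring
    have e₂ : (x : F) + α + α - 3 * α = x - α := by ring
    rw [e₁, e₂, eq_comm, smul_smul, smul_eq_zero_iff_right] at hk
    · exact hk
    · exact mul_ne_zero (by simpa using hx) (sub_ne_zero.mpr fun e => h₃ (Subtype.ext e.symm))
  have right (x y : Γ) (hy : y ≠ 0) : φ 0 (x, y) = 0 := by
    obtain ⟨α, h₁, h₂, h₃⟩ := ((eventually_finsupp_comp_eq_zero (φ 0) (inj₃ x y)).and
      ((eventually_finsupp_comp_eq_zero (φ 0) (inj₄ x y)).and (eventually_cofinite_ne y))).exists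
    have hk := key α x (y + α + α)
    simp only [add_sub_cancel_right, h₁, h₂, smul_zero, zero_add, AddSubgroup.coe_add] at hk
    have e₁ : (y : F) + α + α - 2 * α = y := by ring
    have e₂ : (y : F) + α + α - 3 * α = y - α := by ring
    rw [e₁, e₂, eq_comm, smul_smul, smul_eq_zero_iff_right] at hk
    · exact hk
    · exact mul_ne_zero (by simpa using hy) (sub_ne_zero.mpr fun e => h₃ (Subtype.ext e.symm))
  have zero : φ 0 = 0 := by
    ext ⟨x, y⟩
    rw [Finsupp.zero_apply]
    by_cases hx : x = 0
    · by_cases hy : y = 0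
      · obtain ⟨α, hα⟩ := exists_ne (0 : Γ)
        have hk := key α α α
        rw [left (α - α - α) α (by simpa using hα), right α (α - α - α) (by simpa using hα),
          sub_self] at hk
        have e : (0 : V) = (2 * (α : F) * α) • φ 0 (0, 0) := by
          rw [hk]
          module
        rw [eq_comm, smul_eq_zero_iff_right] at e
        · rw [hx, hy, e]
        · simpa using hα
      · exact right x y hy
    · exact left x y hx
  by_cases hγ : γ = 0
  · rw [hγ, zero]
  · ext p
    have hk := h γ 0 p
    simp only [zero, actLeft, actRight, Finsupp.coe_zero, Pi.zero_apply, smul_zero, add_zero,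
      AddSubgroup.coe_zero, zero_sub] at hk
    rwa [smul_eq_zero_iff_right] at hk
    simpa using hγ

end FinitelySupported

section Cocycle

variable {F : Type*} [Field F] {Γ : AddSubgroup F}
variable {R : Type*} [CommRing R] [IsDomain R] [Algebra F R]

/-- Two families `A`, `B` with `(L_α ⊗ 1) B_β = (1 ⊗ L_β) A_α` for all `α`, `β` have a common
potential `r`: `A_α = (L_α ⊗ 1) r` and `B_β = (1 ⊗ L_β) r`. In coefficients the hypothesis reads
`(x - α) B_β (x, y + β) = (y - β) A_α (x + α, y)`, so `B_β (x, y + β) / (y - β)` does not depend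
on `β`. -/
theorem exists_potential [CharZero F] (hΓ : Γ ≠ ⊥) {V : Type*} [AddCommGroup V] [Module F V]
    (A B : Γ → (Γ × Γ →₀ V))
    (h : ∀ α β p, actLeft α (B β) p = actRight β (A α) p) :
    ∃ r : Γ × Γ →₀ V, (∀ α p, A α p = actLeft α r p) ∧ ∀ β p, B β p = actRight β r p := by
  classical
  have : Infinite Γ := infinite_of_ne_bot hΓ
  have key (α β x y : Γ) :
      ((x : F) - α) • B β (x, y + β) = ((y : F) - β) • A α (x + α, y) := by
    have h' := h α β (x + α, y + β)
    simp only [actLeft, actRight, add_sub_cancel_right, AddSubgroup.coe_add] at h'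
    convert h' using 2 <;> ring
  obtain ⟨δ, hδ⟩ := exists_ne (0 : Γ)
  -- `β = 0` computes the potential where `y ≠ 0`, and `β = δ` where `y = 0`.
  let g : Γ × Γ → V := fun p =>
    if p.2 = 0 then (-(δ : F))⁻¹ • B δ (p.1, p.2 + δ) else (p.2 : F)⁻¹ • B 0 p
  have hg : (Function.support g).Finite := by
    have hinj : Function.Injective fun p : Γ × Γ => (p.1, p.2 + δ) := fun p q hpq => by
      simpa [Prod.ext_iff] using hpq
    refine (((B δ).hasFiniteSupport.preimage hinj.injOn).union (B 0).hasFiniteSupport).subset ?_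
    intro p hp
    by_cases h0 : p.2 = 0
    · exact Or.inl fun h' => hp (by simp only [g, if_pos h0, h', smul_zero])
    · exact Or.inr fun h' => hp (by simp only [g, if_neg h0, h', smul_zero])
  have hA (α x y : Γ) : A α (x + α, y) = ((x : F) - α) • g (x, y) := by
    by_cases h0 : y = 0
    · have hδ' : -(δ : F) ≠ 0 := by simpa using hδ
      have h' := key α δ x y
      simp only [g, if_pos h0]
      rw [smul_comm, h', h0, AddSubgroup.coe_zero, zero_sub, inv_smul_smul₀ hδ']
    · have hy : (y : F) ≠ 0 := by simpa using h0
      have h' := key α 0 x y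
      rw [AddSubgroup.coe_zero, sub_zero, add_zero] at h'
      simp only [g, if_neg h0]
      rw [smul_comm, h', inv_smul_smul₀ hy]
  refine ⟨Finsupp.ofSupportFinite g hg, fun α p => ?_, fun β p => ?_⟩
  · have h' := hA α (p.1 - α) p.2
    rw [sub_add_cancel] at h'
    rw [h', actLeft, Finsupp.ofSupportFinite_coe, AddSubgroup.coe_sub]
    congr 1
    ring
  · obtain ⟨α, hα⟩ := exists_ne p.1
    have hα' : (p.1 : F) - α ≠ 0 := sub_ne_zero.mpr fun e => hα (Subtype.ext e.symm)
    have h' := key α β p.1 (p.2 - β)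
    rw [sub_add_cancel, hA, smul_comm] at h'
    have h'' := smul_right_injective V hα' h'
    rw [h'', actRight, Finsupp.ofSupportFinite_coe, AddSubgroup.coe_sub]
    congr 1
    ring

open Filter in
/-- The coefficient form of `H¹ = 0`. Here `d α i` stands for `D(L_{α,i})` and `X i`, `Y i` for the
multiplications by `tⁱ` in the left and right factor. Modulo `(u - X 1)(u - Y 1)` the elements
`(u - Y 1) L_α` and `(u - X 1) L_α` act on one tensor factor only, and `D` kills the remaining
ideal; this decouples the cocycle condition. -/
theorem exists_coboundary [CharZero F] (hΓ : Γ ≠ ⊥) (X Y : ℤ → R) (hX₀ : X 0 = 1) (hY₀ : Y 0 = 1)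
    (hX : ∀ i j, X (i + j) = X i * X j) (hY : ∀ i j, Y (i + j) = Y i * Y j) (hXY : X 1 ≠ Y 1)
    (d : Γ → ℤ → (Γ × Γ →₀ R))
    (hd : ∀ (α β : Γ) i j p, ((β : F) - α) • d (α + β) (i + j) p =
      X i * actLeft α (d β j) p + Y i * actRight α (d β j) p
        - (X j * actLeft β (d α i) p + Y j * actRight β (d α i) p)) :
    ∃ r : Γ × Γ →₀ R, ∀ α p, d α 0 p = actLeft α r p + actRight α r p := by
  have : Infinite Γ := infinite_of_ne_bot hΓ
  have hX₂ : X 2 = X 1 * X 1 := hX 1 1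
  have hY₂ : Y 2 = Y 1 * Y 1 := hY 1 1
  have hXY' : X 1 - Y 1 ≠ 0 := sub_ne_zero.mpr hXY
  -- the value of `D` on `(u - X 1)(u - Y 1) L_γ`, which acts by zero
  have hK (γ : Γ) : d γ 2 - (X 1 + Y 1) • d γ 1 + (X 1 * Y 1) • d γ 0 = 0 := by
    refine equivariant_eq_zero hΓ
      (fun γ => d γ 2 - (X 1 + Y 1) • d γ 1 + (X 1 * Y 1) • d γ 0) (fun α γ p => ?_) γ
    have h₂ := hd α γ 0 2 p
    have h₁ := hd α γ 0 1 p
    have h₀ := hd α γ 0 0 p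
    simp only [zero_add, hX₀, hY₀, hX₂, hY₂, actLeft, actRight, Algebra.smul_def] at h₂ h₁ h₀
    simp only [actLeft, actRight, Algebra.smul_def, Finsupp.add_apply, Finsupp.sub_apply,
      Finsupp.smul_apply, Algebra.algebraMap_self, RingHom.id_apply]
    linear_combination h₂ - (X 1 + Y 1) * h₁ + X 1 * Y 1 * h₀
  obtain ⟨s, hs₁, hs₂⟩ := exists_potential hΓ (fun α => d α 1 - Y 1 • d α 0)
    (fun β => X 1 • d β 0 - d β 1) fun α β p => by
      have h₁₁ := hd α β 1 1 p
      have h₀₁ := hd α β 0 1 p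
      have h₁₀ := hd α β 1 0 p
      have h₀₀ := hd α β 0 0 p
      have hk := DFunLike.congr_fun (hK (α + β)) p
      rw [one_add_one_eq_two] at h₁₁
      simp only [add_zero, zero_add, hX₀, hY₀, actLeft, actRight, Algebra.smul_def]
        at h₁₁ h₀₁ h₁₀ h₀₀
      simp only [Finsupp.add_apply, Finsupp.sub_apply, Finsupp.smul_apply, smul_eq_mul,
        Finsupp.zero_apply] at hk
      refine mul_left_cancel₀ hXY' ?_
      simp only [actLeft, actRight, Algebra.smul_def, Finsupp.sub_apply, Finsupp.smul_apply,
        Algebra.algebraMap_self, RingHom.id_apply]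
      linear_combination (h₁₁ - Y 1 * h₀₁ - X 1 * h₁₀ + X 1 * Y 1 * h₀₀)
        - algebraMap F R ((β : F) - α) * hk
  have hs (α : Γ) (p : Γ × Γ) : (X 1 - Y 1) * d α 0 p = actLeft α s p + actRight α s p := by
    rw [← hs₁, ← hs₂]
    simp only [Finsupp.sub_apply, Finsupp.smul_apply, smul_eq_mul]
    ring
  -- For `α` off a finite set a single term survives in `hs`, so `X 1 - Y 1` divides `s`.
  have hdvd (p : Γ × Γ) : ∃ q, s p = (X 1 - Y 1) * q := by
    obtain ⟨x, y⟩ := p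
    have inj : Function.Injective fun α : Γ => (x + α, y - α) := fun a b hab => by
      simpa using congrArg Prod.fst hab
    obtain ⟨α, h₁, h₂⟩ :=
      ((eventually_finsupp_comp_eq_zero s inj).and (eventually_cofinite_ne x)).exists
    have hα : (x : F) - α ≠ 0 := sub_ne_zero.mpr fun e => h₂ (Subtype.ext e.symm)
    have h' := hs α (x + α, y)
    simp only [actLeft, actRight, add_sub_cancel_right, h₁, smul_zero, add_zero,
      AddSubgroup.coe_add] at h'
    have e : (x : F) + α - 2 * α = x - α := by ring
    rw [e] at h'
    refine ⟨((x : F) - α)⁻¹ • d α 0 (x + α, y), ?_⟩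
    rw [mul_smul_comm, h', inv_smul_smul₀ hα]
  choose q hq using hdvd
  have hfin : (Function.support q).Finite := by
    refine s.hasFiniteSupport.subset fun p hp hp' => hp ?_
    have h' := hq p
    rw [hp', eq_comm] at h'
    exact (mul_eq_zero.mp h').resolve_left hXY'
  refine ⟨Finsupp.ofSupportFinite q hfin, fun α p => mul_left_cancel₀ hXY' ?_⟩
  rw [hs]
  simp only [actLeft, actRight, Finsupp.ofSupportFinite_coe, hq, mul_add, mul_smul_comm]

end Cocycle

/-! ### Invariants and derivations of a Lie algebra with basis `L_{α,i}` -/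

section Witt

variable {F : Type*} [Field F] {Γ : AddSubgroup F}
variable {L : Type*} [LieRing L] [LieAlgebra F L] (b : Module.Basis (Γ × ℤ) F L)

open Filter in
/-- For any Lie module `N` the elements `L_{α,0}` have no common nonzero invariant in `L ⊗ N`: for
`α` outside a finite set, `L_{α,0}` shifts the support in the first factor off itself. -/
theorem eq_zero_of_lie_eq_zero [CharZero F] (hΓ : Γ ≠ ⊥)
    (hb : ∀ (α β : Γ) i j, ⁅b (α, i), b (β, j)⁆ = ((β : F) - α) • b (α + β, i + j))
    {N : Type*} [AddCommGroup N] [Module F N] [LieRingModule L N] [LieModule F L N]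
    {u : L ⊗[F] N} (hu : ∀ α, ⁅b (α, 0), u⁆ = 0) : u = 0 := by
  classical
  have : Infinite Γ := infinite_of_ne_bot hΓ
  have hrepr (α x : Γ) (i : ℤ) (m : L) :
      b.repr ⁅b (α, 0), m⁆ (x + α, i) = ((x : F) - α) * b.repr m (x, i) := by
    have h : b.coord (x + α, i) ∘ₗ (LieModule.toEnd F L L (b (α, 0)) : L →ₗ[F] L) =
        ((x : F) - α) • b.coord (x, i) := by
      refine b.ext fun ⟨β, j⟩ => ?_
      by_cases hβ : β = x
      · simp [hb, Finsupp.single_apply, hβ, add_comm]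
      · have hβ' : ¬ (α + β = x + α) := by rwa [add_comm, add_left_inj]
        simp [hb, hβ, hβ']
    exact LinearMap.congr_fun h m
  have hcoef (α x : Γ) (i : ℤ) (u : L ⊗[F] N) :
      TensorProduct.equivFinsuppOfBasisLeft b ⁅b (α, 0), u⁆ (x + α, i) =
        ((x : F) - α) • TensorProduct.equivFinsuppOfBasisLeft b u (x, i) +
          ⁅b (α, 0), TensorProduct.equivFinsuppOfBasisLeft b u (x + α, i)⁆ := by
    induction u with
    | zero => simp
    | add u₁ u₂ h₁ h₂ =>
      simp only [lie_add, map_add, Finsupp.add_apply, h₁, h₂, smul_add]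
      abel
    | tmul m n =>
      simp only [TensorProduct.LieModule.lie_tmul_right, map_add, Finsupp.add_apply,
        TensorProduct.equivFinsuppOfBasisLeft_apply_tmul_apply, hrepr, mul_smul, lie_smul]
  refine (TensorProduct.equivFinsuppOfBasisLeft b).map_eq_zero_iff.mp ?_
  ext ⟨x, i⟩
  have hinj : Function.Injective fun α : Γ => (x + α, i) := fun a b hab => by
    simpa using congrArg Prod.fst hab
  obtain ⟨α, h₁, h₂⟩ := ((eventually_finsupp_comp_eq_zero
    (TensorProduct.equivFinsuppOfBasisLeft b u) hinj).and (eventually_cofinite_ne x)).exists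
  have h := hcoef α x i u
  rw [hu, h₁, map_zero, Finsupp.zero_apply, lie_zero, add_zero, eq_comm,
    smul_eq_zero_iff_right] at h
  · exact h
  · exact sub_ne_zero.mpr fun e => h₂ (Subtype.ext e.symm)

/-- Laurent polynomials in two variables `t`, `s`. -/
abbrev Laurent₂ (F : Type*) [Field F] : Type _ := AddMonoidAlgebra F (ℤ × ℤ)

/-- The identification of `L ⊗ L` with finitely supported functions `Γ × Γ → F[t^±, s^±]`, under
which `L_{α,i} ⊗ L_{β,j}` corresponds to `tⁱ sʲ` placed at `(α, β)`. -/
noncomputable def tensorCoord : L ⊗[F] L ≃ₗ[F] (Γ × Γ →₀ Laurent₂ F) :=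
  (b.tensorProduct b).repr ≪≫ₗ
    Finsupp.domLCongr (Equiv.prodProdProdComm Γ ℤ Γ ℤ) ≪≫ₗ
    Finsupp.curryLinearEquiv F ≪≫ₗ
    Finsupp.mapRange.linearEquiv (AddMonoidAlgebra.coeffLinearEquiv F).symm

theorem tensorCoord_basis (α β : Γ) (i j : ℤ) :
    tensorCoord b (b (α, i) ⊗ₜ b (β, j)) =
      Finsupp.single (α, β) (AddMonoidAlgebra.single (i, j) (1 : F)) := by
  have h : b (α, i) ⊗ₜ[F] b (β, j) = b.tensorProduct b ((α, i), (β, j)) := by simp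
  rw [h, tensorCoord, LinearEquiv.trans_apply, LinearEquiv.trans_apply, LinearEquiv.trans_apply,
    Module.Basis.repr_self, Finsupp.domLCongr_single]
  have hc : Finsupp.curryLinearEquiv F
      (Finsupp.single (Equiv.prodProdProdComm Γ ℤ Γ ℤ ((α, i), (β, j))) (1 : F)) =
      Finsupp.single (α, β) (Finsupp.single (i, j) 1) := Finsupp.curry_single _ _
  rw [hc, Finsupp.mapRange.linearEquiv_apply, Finsupp.mapRange_single]
  rfl

theorem tensorCoord_lie
    (hb : ∀ (α β : Γ) i j, ⁅b (α, i), b (β, j)⁆ = ((β : F) - α) • b (α + β, i + j))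
    (α : Γ) (i : ℤ) (u : L ⊗[F] L) (p : Γ × Γ) :
    tensorCoord b ⁅b (α, i), u⁆ p =
      AddMonoidAlgebra.single (i, 0) (1 : F) * actLeft α (tensorCoord b u) p +
        AddMonoidAlgebra.single (0, i) (1 : F) * actRight α (tensorCoord b u) p := by
  classical
  have hu := (b.tensorProduct b).mem_span u
  induction hu using Submodule.span_induction with
  | zero => simp [actLeft, actRight]
  | add u v _ _ hu hv =>
    simp only [lie_add, map_add, Finsupp.add_apply, hu, hv, actLeft, actRight,
      smul_add, mul_add]
    abel
  | smul c u _ hu =>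
    simp only [lie_smul, map_smul, Finsupp.smul_apply, hu, actLeft, actRight,
      smul_add, mul_smul_comm, smul_comm c]
  | mem u hu =>
    obtain ⟨⟨⟨β, j⟩, ⟨γ, k⟩⟩, rfl⟩ := hu
    obtain ⟨x, y⟩ := p
    simp only [Module.Basis.tensorProduct_apply, TensorProduct.LieModule.lie_tmul_right, hb,
      ← TensorProduct.smul_tmul', TensorProduct.tmul_smul, map_add, map_smul, tensorCoord_basis,
      Finsupp.add_apply, Finsupp.smul_apply, actLeft, actRight, Finsupp.single_apply,
      Prod.mk.injEq, eq_sub_iff_add_eq, add_comm α]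
    congr 1
    · by_cases h : β + α = x ∧ γ = y
      · obtain ⟨rfl, rfl⟩ := h
        rw [if_pos ⟨rfl, rfl⟩, if_pos ⟨rfl, rfl⟩, mul_smul_comm,
          AddMonoidAlgebra.single_mul_single, AddSubgroup.coe_add]
        congr 1
        · ring
        · simp
      · simp [h]
    · by_cases h : β = x ∧ γ + α = y
      · obtain ⟨rfl, rfl⟩ := h
        rw [if_pos ⟨rfl, rfl⟩, if_pos ⟨rfl, rfl⟩, mul_smul_comm,
          AddMonoidAlgebra.single_mul_single, AddSubgroup.coe_add]
        congr 1
        · ring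
        · simp
      · simp [h]

/-- `H¹(L, L ⊗ L) = 0`: every derivation `L → L ⊗ L` is inner. -/
theorem exists_eq_coboundaryMap [CharZero F] (hΓ : Γ ≠ ⊥)
    (hb : ∀ (α β : Γ) i j, ⁅b (α, i), b (β, j)⁆ = ((β : F) - α) • b (α + β, i + j))
    (D : L →ₗ[F] L ⊗[F] L) (hD : ∀ x y, D ⁅x, y⁆ = ⁅x, D y⁆ - ⁅y, D x⁆) :
    ∃ r, D = coboundaryMap F r := by
  have hX (i j : ℤ) : (AddMonoidAlgebra.single (i + j, 0) 1 : Laurent₂ F) =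
      AddMonoidAlgebra.single (i, 0) 1 * AddMonoidAlgebra.single (j, 0) 1 := by
    simp [AddMonoidAlgebra.single_mul_single]
  have hY (i j : ℤ) : (AddMonoidAlgebra.single (0, i + j) 1 : Laurent₂ F) =
      AddMonoidAlgebra.single (0, i) 1 * AddMonoidAlgebra.single (0, j) 1 := by
    simp [AddMonoidAlgebra.single_mul_single]
  obtain ⟨f, hf⟩ := exists_coboundary hΓ
    (fun i => (AddMonoidAlgebra.single (i, 0) 1 : Laurent₂ F))
    (fun i => AddMonoidAlgebra.single (0, i) 1) rfl rfl hX hY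
    (by simp [AddMonoidAlgebra.single_left_inj])
    (fun α i => tensorCoord b (D (b (α, i)))) fun α β i j p => by
      rw [← tensorCoord_lie b hb, ← tensorCoord_lie b hb, ← Finsupp.sub_apply, ← map_sub, ← hD, hb,
        map_smul, map_smul, Finsupp.smul_apply]
  set r := (tensorCoord b).symm f with hr
  have h₀ (α : Γ) : (D - coboundaryMap F r) (b (α, 0)) = 0 := by
    rw [LinearMap.sub_apply, sub_eq_zero, coboundaryMap_apply]
    refine (tensorCoord b).injective (Finsupp.ext fun p => ?_)
    rw [hf, tensorCoord_lie b hb, hr, LinearEquiv.apply_symm_apply]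
    exact congrArg₂ (· + ·) (one_mul _).symm (one_mul _).symm
  refine ⟨r, sub_eq_zero.mp (b.ext fun ⟨γ, i⟩ => (tensorCoord b).map_eq_zero_iff.mp ?_)⟩
  refine equivariant_eq_zero hΓ (fun γ => tensorCoord b ((D - coboundaryMap F r) (b (γ, i))))
    (fun α γ p => ?_) γ
  have h : ((γ : F) - α) • (D - coboundaryMap F r) (b (α + γ, i)) =
      ⁅b (α, 0), (D - coboundaryMap F r) (b (γ, i))⁆ := by
    have h' := h₀ α
    rw [LinearMap.sub_apply, sub_eq_zero] at h'
    rw [← map_smul, ← zero_add i, ← hb, zero_add, LinearMap.sub_apply, LinearMap.sub_apply, hD, h',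
      lie_sub, coboundaryMap_apply, coboundaryMap_apply, coboundaryMap_apply, lie_lie]
    abel
  have h' := DFunLike.congr_fun (congrArg (tensorCoord b) h) p
  rw [map_smul, Finsupp.smul_apply, tensorCoord_lie b hb] at h'
  exact h'.trans (congrArg₂ (· + ·) (one_mul _) (one_mul _))

end Witt

/-! ### The generalized loop Virasoro algebra -/

section Loop

variable {F : Type*} [Field F] (Γ : AddSubgroup F)

/-- The basis `L_{α,i}` of the generalized loop Virasoro algebra. -/
noncomputable def loopBasis : Module.Basis (Γ × ℤ) F (LoopVirasoro Γ) :=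
  ((AddMonoidAlgebra.basis ℤ F).tensorProduct ((AddMonoidAlgebra.basis Γ F).map (toW Γ))).reindex
    (Equiv.prodComm ℤ Γ)

theorem loopBasis_apply (α : Γ) (i : ℤ) : loopBasis Γ (α, i) = loopL Γ α i := by
  simp [loopBasis, loopL, wittL]

theorem loopBasis_lie (α β : Γ) (i j : ℤ) :
    ⁅loopBasis Γ (α, i), loopBasis Γ (β, j)⁆ =
      ((β : F) - α) • loopBasis Γ (α + β, i + j) := by
  simp only [loopBasis_apply, loopL_lie]

end Loop

end LieBialg

theorem theorem3p5 {F : Type*} [Field F] [CharZero F] (Γ : AddSubgroup F) (hΓ : Γ ≠ ⊥)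
    (Δ : LieBialg.LoopVirasoro Γ →ₗ[F] LieBialg.LoopVirasoro Γ ⊗[F] LieBialg.LoopVirasoro Γ)
    (hΔ : LieBialg.IsLieBialgebra F Δ) :
    ∃ r : LieBialg.LoopVirasoro Γ ⊗[F] LieBialg.LoopVirasoro Γ,
      LieBialg.IsCoboundaryTriangular F Δ r := by
  have hb := LieBialg.loopBasis_lie Γ
  obtain ⟨r, rfl⟩ := LieBialg.exists_eq_coboundaryMap (LieBialg.loopBasis Γ) hΓ hb Δ hΔ.compat
  have hskew : r ∈ LieBialg.skewTensors F (LieBialg.LoopVirasoro Γ) := by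
    refine LieBialg.mem_skewTensors_of_twist_eq_neg F (eq_neg_of_add_eq_zero_left ?_)
    refine LieBialg.eq_zero_of_lie_eq_zero (LieBialg.loopBasis Γ) hΓ hb fun α => ?_
    have h := LieBialg.twist_eq_neg_of_mem_skewTensors F
      (hΔ.range_le ⟨LieBialg.loopBasis Γ (α, 0), rfl⟩)
    rw [LieBialg.coboundaryMap_apply, LieBialg.twist_lie] at h
    rw [lie_add, h, neg_add_cancel]
  refine ⟨r, ⟨hΔ, hskew, fun _ => rfl⟩, ?_⟩
  have hyb : LieBialg.yangBaxter F (LieBialg.LoopVirasoro Γ) (r ⊗ₜ r) = 0 :=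
    LieBialg.eq_zero_of_lie_eq_zero (LieBialg.loopBasis Γ) hΓ hb fun α => by
      rw [← LieBialg.coJacobi_coboundaryMap F hskew]
      exact LinearMap.congr_fun hΔ.coJacobi (LieBialg.loopBasis Γ (α, 0))
  rw [LieBialg.cybe_eq_map_yangBaxter, hyb, map_zero]
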